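/- All systems are finite-dimensional, identified with $\mathbb{C}^n$ carrying its standard basis; operators are complex matrices and $\leq$ is the Loewner order. A state is a positive semi-definite operator of trace one; a channel is a completely positive trace-preserving linear map. $T_X$ denotes the (partial) transpose on system $X$ in the standard basis. For linear maps $\mathcal{N},\mathcal{M}$ from operators on $C$ to operators on $D$, put $$\|\mathcal{N}-\mathcal{M}\|_\diamond=\sup_{R,\ \rho_{RC}}\big\|(\mathrm{id}_R\otimes\mathcal{N})(\rho_{RC})-(\mathrm{id}_R\otimes\mathcal{M})(\rho_{RC})\big\|_1,$$ the supremum being over all finite-dimensional reference systems $R$ and all states $\rho_{RC}$, with $\|X\|_1=\operatorname{Tr}\sqrt{X^\dagger X}$; and let $\Gamma^{\mathcal{N}}_{CD}=\sum_{i,j}|i\rangle\langle j|\otimes\mathcal{N}(|i\rangle\langle j|)$ be the Choi operator of $\mathcal{N}$. A bipartite channel $\mathcal{P}_{AB\to A'B'}$ is C-PPT-P if $T_{B'}\circ\mathcal{P}\circ T_B$ is completely positive. For a bipartite channel $\mathcal{N}_{AB\to A'B'}$ and a bipartite resource state $\rho_{\hat A\hat B}$, define the simulation error $$e_{\mathrm{PPT}}(\mathcal{N},\rho_{\hat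 A\hat B})=\frac12\inf_{\mathcal{P}}\big\|\mathcal{N}-\widetilde{\mathcal{N}}\big\|_\diamond,\qquad \widetilde{\mathcal{N}}(\omega_{AB})=\mathcal{P}(\omega_{AB}\otimes\rho_{\hat A\hat B}),$$ where the infimum is over all C-PPT-P channels $\mathcal{P}_{AB\hat A\hat B\to A'B'}$ (Alice holds $A\hat A$, Bob holds $B\hat B$; that is, $T_{B'}\circ\mathcal{P}\circ T_{B\hat B}$ is completely positive). Define also $v_{\mathrm{PPT}}(\mathcal{N},\rho_{\hat A\hat B})$ as the optimal value of the semi-definite program $$\inf\ \mu\quad\text{over}\quad \mu\geq0,\ Z_{ABA'B'}\geq0,\ P_{AB\hat A\hat BA'B'}\geq0$$ subject to $\operatorname{Tr}_{A'B'}[Z_{ABA'B'}]\leq\mu I_{AB}$, $T_{B\hat BB'}(P)\geq0$, $\operatorname{Tr}_{A'B'}[P]=I_{AB\hat A\hat B}$ and $Z_{ABA'B'}\geq\Gamma^{\mathcal{N}}_{ABA'B'}-\operatorname{Tr}_{\hat A\hat B}[T_{\hat A\hat B}(\rho_{\hat A\hat B})P]$. **Proposition.** Let $d\geq2$, let $A,B$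 have dimension $d$, let $F_{AB}=\sum_{i,j=0}^{d-1}|i\rangle\langle j|_A\otimes|j\rangle\langle i|_B$, and let $\mathcal{S}^d_{AB}(\omega)=F_{AB}\,\omega\,F_{AB}^\dagger$ be the unitary swap channel. Let $\hat A,\hat B$ be finite-dimensional systems of arbitrary, possibly different, dimensions, and let $\rho_{\hat A\hat B}$ be a state. Then $$e_{\mathrm{PPT}}(\mathcal{S}^d_{AB},\rho_{\hat A\hat B})=v_{\mathrm{PPT}}(\mathcal{S}^d_{AB},\rho_{\hat A\hat B})=1-\sup_{K,L,M,N}\operatorname{Tr}[\rho_{\hat A\hat B}K],$$ where the supremum is over all positive semi-definite operators $K,L,M,N$ on $\hat A\hat B$ such that $$K+L+M+N=I_{\hat A\hat B},$$ $$T_{\hat B}\Big(K+\frac{L}{d+1}+\frac{M}{d+1}+\frac{N}{(d+1)^2}\Big)\geq0,$$ $$\frac1{d-1}T_{\hat B}\Big(L+\frac{N}{d+1}\Big)\geq T_{\hat B}\Big(K+\frac{M}{d+1}\Big),$$ $$\frac1{d-1}T_{\hat B}\Big(M+\frac{N}{d+1}\Big)\geq T_{\hat B}\Big(K+\frac{L}{d+1}\Big),$$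 $$T_{\hat B}\Big(K+\frac{N}{(d-1)^2}\Big)\geq\frac1{d-1}T_{\hat B}(L+M).$$ The set of such $(K,L,M,N)$ is non-empty and $\operatorname{Tr}[\rho_{\hat A\hat B}K]$ is bounded above on it. -/

import Mathlib

open scoped ComplexOrder MatrixOrder Kronecker

namespace PPTSim

/-!
Finite-dimensional quantum systems are represented by finite index types (labelling an orthonormal
basis), operators by complex matrices, and a tensor product of systems by the product of index
types. The order `≤` on matrices is the Loewner order (scope `MatrixOrder`).
-/

section General

variable {C D R : Type*} [Fintype C] [DecidableEq C] [Fintype D] [DecidableEq D]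
  [Fintype R] [DecidableEq R]

/-- A quantum state: a positive semi-definite operator of trace one. -/
def IsState (ρ : Matrix C C ℂ) : Prop := 0 ≤ ρ ∧ ρ.trace = 1

/-- The trace norm `Tr √(X† X)`. -/
noncomputable def traceNorm (X : Matrix C C ℂ) : ℝ := (CFC.abs X).trace.re

/-- `(id_R ⊗ Φ)(X)`: the map `Φ` acts on each `C`-block of `X`. -/
def ampliate (Φ : Matrix C C ℂ →ₗ[ℂ] Matrix D D ℂ) (X : Matrix (R × C) (R × C) ℂ) :
    Matrix (R × D) (R × D) ℂ :=
  Matrix.of fun p q => Φ (Matrix.of fun c c' => X (p.1, c) (q.1, c')) p.2 q.2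

/-- Complete positivity: `id_R ⊗ Φ` preserves positivity for every finite-dimensional `R`. -/
def IsCP (Φ : Matrix C C ℂ →ₗ[ℂ] Matrix D D ℂ) : Prop :=
  ∀ (k : ℕ) (X : Matrix (Fin k × C) (Fin k × C) ℂ), 0 ≤ X → 0 ≤ ampliate Φ X

/-- A quantum channel: a completely positive and trace-preserving linear map. -/
def IsChannel (Φ : Matrix C C ℂ →ₗ[ℂ] Matrix D D ℂ) : Prop :=
  IsCP Φ ∧ ∀ X, (Φ X).trace = X.trace

/-- The diamond distance: the supremum, over all reference systems `R` and all states `ρ` of `RC`,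
of the trace norm of `N(ρ) - M(ρ)`. -/
noncomputable def diamondDist (N M : Matrix C C ℂ →ₗ[ℂ] Matrix D D ℂ) : ℝ :=
  sSup {t : ℝ | ∃ (r : ℕ) (ρ : Matrix (Fin r × C) (Fin r × C) ℂ), IsState ρ ∧
    t = traceNorm (ampliate N ρ - ampliate M ρ)}

/-- The unnormalized maximally entangled operator `|Γ⟩⟨Γ|` on `C ⊗ C`, `|Γ⟩ = ∑ i, |i⟩|i⟩`. -/
def maxEnt (C : Type*) [DecidableEq C] : Matrix (C × C) (C × C) ℂ :=
  Matrix.of fun p q => (if p.1 = p.2 then 1 else 0) * (if q.1 = q.2 then 1 else 0)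

/-- The Choi operator of a linear map (reference system first). -/
def choi (Φ : Matrix C C ℂ →ₗ[ℂ] Matrix D D ℂ) : Matrix (C × D) (C × D) ℂ :=
  ampliate Φ (maxEnt C)

/-- Partial trace over the second tensor factor. -/
def partialTrace₂ (X : Matrix (C × D) (C × D) ℂ) : Matrix C C ℂ :=
  Matrix.of fun c c' => ∑ d, X (c, d) (c', d)

/-- Partial transpose on the second tensor factor. -/
def partialTranspose₂ : Matrix (C × D) (C × D) ℂ →ₗ[ℂ] Matrix (C × D) (C × D) ℂ where
  toFun X := Matrix.of fun p q => X (p.1, q.2) (q.1, p.2)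
  map_add' _ _ := rfl
  map_smul' _ _ := rfl

end General

section Bipartite

variable {A B A' B' Ahat Bhat : Type*}
  [Fintype A] [DecidableEq A] [Fintype B] [DecidableEq B]
  [Fintype A'] [DecidableEq A'] [Fintype B'] [DecidableEq B']
  [Fintype Ahat] [DecidableEq Ahat] [Fintype Bhat] [DecidableEq Bhat]

/-- A bipartite map `P` from `A ⊗ B` to `A' ⊗ B'` completely preserves the positivity of the partial
transpose if `T_{B'} ∘ P ∘ T_B` is completely positive. -/
def IsCPPTP (P : Matrix (A × B) (A × B) ℂ →ₗ[ℂ] Matrix (A' × B') (A' × B') ℂ) : Prop :=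
  IsCP (partialTranspose₂ ∘ₗ P ∘ₗ partialTranspose₂)

/-- The map `ω ↦ P(ω ⊗ ρ)`, where Alice holds `A, Ahat` and Bob holds `B, Bhat`. -/
def simulate
    (P : Matrix ((A × Ahat) × (B × Bhat)) ((A × Ahat) × (B × Bhat)) ℂ →ₗ[ℂ]
      Matrix (A' × B') (A' × B') ℂ)
    (ρ : Matrix (Ahat × Bhat) (Ahat × Bhat) ℂ) :
    Matrix (A × B) (A × B) ℂ →ₗ[ℂ] Matrix (A' × B') (A' × B') ℂ where
  toFun ω := P ((ω ⊗ₖ ρ).reindex (Equiv.prodProdProdComm A B Ahat Bhat)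
    (Equiv.prodProdProdComm A B Ahat Bhat))
  map_add' X Y := by
    rw [Matrix.add_kronecker, ← map_add]; rfl
  map_smul' c X := by
    rw [Matrix.smul_kronecker, RingHom.id_apply, ← map_smul]; rfl

/-- The error, in normalized diamond distance, of simulating the bipartite map `N` with the
resource state `ρ` and C-PPT-P channels. -/
noncomputable def pptError
    (N : Matrix (A × B) (A × B) ℂ →ₗ[ℂ] Matrix (A' × B') (A' × B') ℂ)
    (ρ : Matrix (Ahat × Bhat) (Ahat × Bhat) ℂ) : ℝ :=
  (1 / 2) * sInf {t : ℝ |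
    ∃ P : Matrix ((A × Ahat) × (B × Bhat)) ((A × Ahat) × (B × Bhat)) ℂ →ₗ[ℂ]
        Matrix (A' × B') (A' × B') ℂ,
      IsChannel P ∧ IsCPPTP P ∧ t = diamondDist N (simulate P ρ)}

/-- The partial transpose `T_{BB'}` on operators on `(A ⊗ B) ⊗ (A' ⊗ B')`. -/
def bobTranspose (X : Matrix ((A × B) × (A' × B')) ((A × B) × (A' × B')) ℂ) :
    Matrix ((A × B) × (A' × B')) ((A × B) × (A' × B')) ℂ :=
  Matrix.of fun p q =>
    X ((p.1.1, q.1.2), (p.2.1, q.2.2)) ((q.1.1, p.1.2), (q.2.1, p.2.2))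

/-- Reordering of the tensor factors that moves `Ahat, Bhat` to the end. -/
def resourceLast (A B A' B' Ahat Bhat : Type*) :
    ((A × Ahat) × (B × Bhat)) × (A' × B') ≃ ((A × B) × (A' × B')) × (Ahat × Bhat) where
  toFun x := (((x.1.1.1, x.1.2.1), x.2), (x.1.1.2, x.1.2.2))
  invFun y := (((y.1.1.1, y.2.1), (y.1.1.2, y.2.2)), y.1.2)
  left_inv _ := rfl
  right_inv _ := rfl

/-- `Tr_{Ahat Bhat}[T_{Ahat Bhat}(ρ) P]`. -/
def contractResource (ρ : Matrix (Ahat × Bhat) (Ahat × Bhat) ℂ)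
    (P : Matrix (((A × Ahat) × (B × Bhat)) × (A' × B')) (((A × Ahat) × (B × Bhat)) × (A' × B')) ℂ) :
    Matrix ((A × B) × (A' × B')) ((A × B) × (A' × B')) ℂ :=
  partialTrace₂ (((1 : Matrix ((A × B) × (A' × B')) ((A × B) × (A' × B')) ℂ) ⊗ₖ ρ.transpose) *
    P.reindex (resourceLast A B A' B' Ahat Bhat) (resourceLast A B A' B' Ahat Bhat))

/-- Feasibility of `(μ, Z, P)` in the semi-definite program for the C-PPT-P simulation of `N` with
the resource state `ρ`. -/
structure IsSimFeasible
    (N : Matrix (A × B) (A × B) ℂ →ₗ[ℂ] Matrix (A' × B') (A' × B') ℂ)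
    (ρ : Matrix (Ahat × Bhat) (Ahat × Bhat) ℂ) (μ : ℝ)
    (Z : Matrix ((A × B) × (A' × B')) ((A × B) × (A' × B')) ℂ)
    (P : Matrix (((A × Ahat) × (B × Bhat)) × (A' × B')) (((A × Ahat) × (B × Bhat)) × (A' × B')) ℂ) :
    Prop where
  mu_nonneg : 0 ≤ μ
  Z_nonneg : 0 ≤ Z
  P_nonneg : 0 ≤ P
  le_mu : partialTrace₂ Z ≤ μ • (1 : Matrix (A × B) (A × B) ℂ)
  ppt : 0 ≤ bobTranspose P
  trace_eq : partialTrace₂ P = 1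
  le_Z : choi N - contractResource ρ P ≤ Z

/-- The optimal value of the semi-definite program for the C-PPT-P simulation error. -/
noncomputable def simValue
    (N : Matrix (A × B) (A × B) ℂ →ₗ[ℂ] Matrix (A' × B') (A' × B') ℂ)
    (ρ : Matrix (Ahat × Bhat) (Ahat × Bhat) ℂ) : ℝ :=
  sInf {μ : ℝ | ∃ Z P, IsSimFeasible N ρ μ Z P}

end Bipartite

section Swap

/-- The unitary swap operator `F = ∑ i j, |i⟩⟨j| ⊗ |j⟩⟨i|`. -/
def swapOp (d : ℕ) : Matrix (Fin d × Fin d) (Fin d × Fin d) ℂ :=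
  ∑ i : Fin d, ∑ j : Fin d, Matrix.single i j (1 : ℂ) ⊗ₖ Matrix.single j i (1 : ℂ)

/-- The unitary swap channel `X ↦ F X F†`. -/
def swapChannel (d : ℕ) : Matrix (Fin d × Fin d) (Fin d × Fin d) ℂ →ₗ[ℂ]
    Matrix (Fin d × Fin d) (Fin d × Fin d) ℂ where
  toFun X := swapOp d * X * (swapOp d).conjTranspose
  map_add' X Y := by rw [Matrix.mul_add, Matrix.add_mul]
  map_smul' c X := by simp

variable {Ahat Bhat : Type*} [Fintype Ahat] [DecidableEq Ahat] [Fintype Bhat] [DecidableEq Bhat]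

/-- Feasible `(K, L, M, N)` of the simplified semi-definite program: a four-outcome POVM subject to
four partial-transpose inequalities. -/
structure IsSwapFeasible (d : ℕ) (K L M N : Matrix (Ahat × Bhat) (Ahat × Bhat) ℂ) : Prop where
  K_nonneg : 0 ≤ K
  L_nonneg : 0 ≤ L
  M_nonneg : 0 ≤ M
  N_nonneg : 0 ≤ N
  ppt₁ : 0 ≤ partialTranspose₂
    (K + (1 / ((d : ℝ) + 1)) • L + (1 / ((d : ℝ) + 1)) • M + (1 / ((d : ℝ) + 1) ^ 2) • N)
  ppt₂ : partialTranspose₂ (K + (1 / ((d : ℝ) + 1)) • M) ≤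
    (1 / ((d : ℝ) - 1)) • partialTranspose₂ (L + (1 / ((d : ℝ) + 1)) • N)
  ppt₃ : partialTranspose₂ (K + (1 / ((d : ℝ) + 1)) • L) ≤
    (1 / ((d : ℝ) - 1)) • partialTranspose₂ (M + (1 / ((d : ℝ) + 1)) • N)
  ppt₄ : (1 / ((d : ℝ) - 1)) • partialTranspose₂ (L + M) ≤
    partialTranspose₂ (K + (1 / ((d : ℝ) - 1) ^ 2) • N)
  sum_eq : K + L + M + N = 1

/-- The objective values `Tr[ρ K]` of the simplified semi-definite program. -/
def swapObjective (d : ℕ) (ρ : Matrix (Ahat × Bhat) (Ahat × Bhat) ℂ) : Set ℝ :=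
  {t : ℝ | ∃ K L M N : Matrix (Ahat × Bhat) (Ahat × Bhat) ℂ,
    IsSwapFeasible d K L M N ∧ t = (ρ * K).trace.re}

end Swap

end PPTSim

/-!
The Choi operator of the swap factorizes: it is the maximally entangled operator `Γ` on the leg
`A → B'` tensored with `Γ` on the leg `B → A'`. Testing the two legs of the Choi operator of a
simulation with the projection `Φ` onto `Γ` and its complement `1 - Φ` leaves a four-outcome POVM
`(K, L, M, N)` on the resource. Conversely, a simulation measures such a POVM on the resource and
acts on each leg as the identity or as the channel whose Choi operator is a multiple of `1 - Φ`.
The partial transposes of `Φ` and `1 - Φ` are combinations of the symmetric and antisymmetric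
projections, so both directions translate the PPT condition into the same four inequalities, one for
each pair of symmetry types. In either formulation of the error, such a POVM achieves the value
`1 - Tr[ρ K]`, because the simulation dominates `Tr[ρ K]` times the swap; and the test `Φ ⊗ Φ`
shows that no simulation does better than its POVM.
-/

namespace PPTSim

open Matrix

section LoewnerOrder

variable {C D : Type*}

theorem nonneg_submatrix {X : Matrix C C ℂ} (hX : 0 ≤ X) (f : D → C) : 0 ≤ X.submatrix f f :=
  nonneg_iff_posSemidef.2 ((nonneg_iff_posSemidef.1 hX).submatrix f)

theorem nonneg_transpose {X : Matrix C C ℂ} (hX : 0 ≤ X) : 0 ≤ Xᵀ :=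
  nonneg_iff_posSemidef.2 (nonneg_iff_posSemidef.1 hX).transpose

theorem nonneg_kronecker [Finite C] [Finite D] {X : Matrix C C ℂ} {Y : Matrix D D ℂ}
    (hX : 0 ≤ X) (hY : 0 ≤ Y) : 0 ≤ X ⊗ₖ Y :=
  nonneg_iff_posSemidef.2
    ((nonneg_iff_posSemidef.1 hX).kronecker (nonneg_iff_posSemidef.1 hY))

variable [Fintype C] [Fintype D]

theorem trace_submatrix_equiv (X : Matrix C C ℂ) (e : D ≃ C) :
    (X.submatrix e e).trace = X.trace :=
  e.sum_comp fun c => X c c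

theorem trace_re_nonneg {X : Matrix C C ℂ} (hX : 0 ≤ X) : 0 ≤ X.trace.re :=
  (Complex.nonneg_iff.1 (nonneg_iff_posSemidef.1 hX).trace_nonneg).1

theorem trace_mul_nonneg {X Y : Matrix C C ℂ} (hX : 0 ≤ X) (hY : 0 ≤ Y) :
    0 ≤ (X * Y).trace := by
  classical
  obtain ⟨B, rfl⟩ := CStarAlgebra.nonneg_iff_eq_star_mul_self.1 hY
  rw [← Matrix.mul_assoc, Matrix.trace_mul_comm, ← Matrix.mul_assoc]
  exact ((nonneg_iff_posSemidef.1 hX).mul_mul_conjTranspose_same B).trace_nonneg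

theorem trace_mul_re_nonneg {X Y : Matrix C C ℂ} (hX : 0 ≤ X) (hY : 0 ≤ Y) :
    0 ≤ (X * Y).trace.re :=
  (Complex.nonneg_iff.1 (trace_mul_nonneg hX hY)).1

end LoewnerOrder

section TraceNorm

variable {C D : Type*} [Fintype C] [DecidableEq C] [Fintype D] [DecidableEq D]

theorem traceNorm_submatrix_equiv (X : Matrix C C ℂ) (e : D ≃ C) :
    traceNorm (X.submatrix e e) = traceNorm X := by
  have abs_submatrix : CFC.abs (X.submatrix e e) = (CFC.abs X).submatrix e e := by
    refine CFC.sqrt_unique ?_ (nonneg_submatrix (CFC.abs_nonneg X) e)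
    rw [submatrix_mul_equiv, CFC.abs_mul_abs, star_eq_conjTranspose, star_eq_conjTranspose,
      conjTranspose_submatrix, submatrix_mul_equiv]
  rw [traceNorm, abs_submatrix, trace_submatrix_equiv, traceNorm]

theorem two_mul_trace_sub_le_traceNorm {X W : Matrix C C ℂ} (hX : X.IsHermitian) (hW : 0 ≤ W)
    (hW1 : W ≤ 1) : 2 * (W * X).trace.re - X.trace.re ≤ traceNorm X := by
  have hs : IsSelfAdjoint X := hX
  have abs_sub_nonneg : 0 ≤ CFC.abs X - X := by
    rw [CFC.abs_sub_self X hs]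
    exact nsmul_nonneg (CFC.negPart_nonneg X) 2
  have abs_add_nonneg : 0 ≤ CFC.abs X + X := by
    rw [CFC.abs_add_self X hs]
    exact nsmul_nonneg (CFC.posPart_nonneg X) 2
  have h₁ := trace_mul_re_nonneg hW abs_sub_nonneg
  have h₂ := trace_mul_re_nonneg (sub_nonneg.2 hW1) abs_add_nonneg
  simp only [Matrix.mul_sub, Matrix.mul_add, Matrix.sub_mul, Matrix.one_mul, Matrix.trace_sub,
    Matrix.trace_add, Complex.sub_re, Complex.add_re] at h₁ h₂
  rw [traceNorm]
  linarith

theorem exists_traceNorm_eq_two_mul_trace_sub {X : Matrix C C ℂ} (hX : X.IsHermitian) :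
    ∃ W : Matrix C C ℂ, 0 ≤ W ∧ W ≤ 1 ∧ traceNorm X = 2 * (W * X).trace.re - X.trace.re := by
  -- The optimal test is the spectral projection of `X` onto its nonnegative eigenvalues.
  let f : ℝ → ℝ := fun x => if 0 ≤ x then 1 else 0
  have hs : IsSelfAdjoint X := hX
  have hf : ContinuousOn f (spectrum ℝ X) := Matrix.finite_real_spectrum.continuousOn f
  have norm_eq : (fun x : ℝ => ‖x‖) = fun x => 2 * (f x * x) - x := by
    funext x
    dsimp only [f]
    split_ifs with hx
    · rw [Real.norm_of_nonneg hx]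
      ring
    · rw [Real.norm_of_nonpos (not_le.1 hx).le]
      ring
  have abs_eq : CFC.abs X = (2 : ℝ) • (cfc f X * X) - X := by
    rw [CFC.abs_eq_cfc_norm X hs, norm_eq, cfc_sub .., cfc_const_mul .., cfc_mul .., cfc_id' ℝ X]
  refine ⟨cfc f X, cfc_nonneg fun x _ => ?_, cfc_le_one _ _ fun x _ => ?_, ?_⟩
  · dsimp only [f]; split_ifs <;> simp
  · dsimp only [f]; split_ifs <;> simp
  · rw [traceNorm, abs_eq]
    simp

theorem traceNorm_sub_le {X Y : Matrix C C ℂ} (hX : 0 ≤ X) (hY : 0 ≤ Y) :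
    traceNorm (X - Y) ≤ X.trace.re + Y.trace.re := by
  obtain ⟨W, hW, hW1, hXY⟩ := exists_traceNorm_eq_two_mul_trace_sub
    ((nonneg_iff_posSemidef.1 hX).isHermitian.sub (nonneg_iff_posSemidef.1 hY).isHermitian)
  have hWX := trace_mul_re_nonneg (sub_nonneg.2 hW1) hX
  have hWY := trace_mul_re_nonneg hW hY
  simp only [Matrix.mul_sub, Matrix.sub_mul, Matrix.one_mul, Matrix.trace_sub,
    Complex.sub_re] at hXY hWX
  linarith

end TraceNorm

section Choi

variable {C D R : Type*}

theorem choi_apply [DecidableEq C] (Φ : Matrix C C ℂ →ₗ[ℂ] Matrix D D ℂ) (p q : C × D) :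
    choi Φ p q = Φ (single p.1 q.1 1) p.2 q.2 := by
  have maxEnt_block : (of fun c c' => maxEnt C (p.1, c) (q.1, c')) = single p.1 q.1 (1 : ℂ) := by
    ext c c'
    simp [maxEnt, single_apply, ← ite_and, and_comm]
  rw [choi, ampliate, of_apply, maxEnt_block]

theorem maxEnt_nonneg [Finite C] [DecidableEq C] : 0 ≤ maxEnt C := by
  have maxEnt_eq : maxEnt C = vecMulVec (fun p : C × C => if p.1 = p.2 then (1 : ℂ) else 0)
      (star fun p : C × C => if p.1 = p.2 then (1 : ℂ) else 0) := by
    ext p q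
    simp [maxEnt, vecMulVec_apply, apply_ite (starRingEnd ℂ)]
  rw [nonneg_iff_posSemidef, maxEnt_eq]
  exact posSemidef_vecMulVec_self_star _

theorem choi_nonneg_of_isCP [Finite C] [DecidableEq C] {Φ : Matrix C C ℂ →ₗ[ℂ] Matrix D D ℂ}
    (hΦ : IsCP Φ) : 0 ≤ choi Φ := by
  let e := Finite.equivFin C
  have relabelled := hΦ (Nat.card C) _ <|
    nonneg_submatrix (maxEnt_nonneg (C := C)) (Prod.map e.symm id)
  have choi_eq : choi Φ = (ampliate Φ ((maxEnt C).submatrix (Prod.map e.symm id)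
      (Prod.map e.symm id))).submatrix (Prod.map e id) (Prod.map e id) := by
    ext
    simp [choi, ampliate]
  exact choi_eq ▸ nonneg_submatrix relabelled _

theorem sum_blocks_nonneg [Fintype C] [Finite D] {X : Matrix (D × C) (D × C) ℂ} (hX : 0 ≤ X) :
    0 ≤ (of fun p q => ∑ c, ∑ c', X (p, c) (q, c') : Matrix D D ℂ) := by
  classical
  have := Fintype.ofFinite D
  let V : Matrix (D × C) D ℂ := of fun x p => if x.1 = p then 1 else 0
  have sum_blocks_eq : (of fun p q => ∑ c, ∑ c', X (p, c) (q, c') : Matrix D D ℂ) = Vᴴ * X * V := by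
    ext p q
    simp only [V, mul_apply, conjTranspose_apply, of_apply, Fintype.sum_prod_type]
    simp only [RCLike.star_def, apply_ite (starRingEnd ℂ), map_one, map_zero, ite_mul, one_mul,
      zero_mul, Finset.sum_ite_irrel, Finset.sum_const_zero, Finset.sum_ite_eq', Finset.mem_univ,
      ↓reduceIte, mul_ite, mul_one, mul_zero]
    exact Finset.sum_comm
  rw [sum_blocks_eq]
  exact nonneg_iff_posSemidef.2 ((nonneg_iff_posSemidef.1 hX).conjTranspose_mul_mul_same V)

section OfChoi

variable [Fintype C]

/-- The linear map with Choi operator `J`, linearly in `J`. -/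
def ofChoi : Matrix (C × D) (C × D) ℂ →ₗ[ℂ] Matrix C C ℂ →ₗ[ℂ] Matrix D D ℂ :=
  LinearMap.mk₂ ℂ (fun J X => of fun p q => ∑ c, ∑ c', X c c' * J (c, p) (c', q))
    (fun J J' X => by ext; simp [mul_add, Finset.sum_add_distrib])
    (fun a J X => by ext; simp [Finset.mul_sum, mul_left_comm])
    (fun J X X' => by ext; simp [add_mul, Finset.sum_add_distrib])
    (fun a J X => by ext; simp [Finset.mul_sum, mul_assoc])

theorem ofChoi_apply (J : Matrix (C × D) (C × D) ℂ) (X : Matrix C C ℂ) (p q : D) :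
    ofChoi J X p q = ∑ c, ∑ c', X c c' * J (c, p) (c', q) := rfl

theorem trace_ofChoi [Fintype D] (J : Matrix (C × D) (C × D) ℂ) (X : Matrix C C ℂ) :
    (ofChoi J X).trace = (Xᵀ * partialTrace₂ J).trace := by
  simp only [trace, diag_apply, ofChoi_apply, mul_apply, partialTrace₂, of_apply, transpose_apply,
    Finset.mul_sum]
  rw [Finset.sum_comm_cycle]
  exact Finset.sum_congr rfl fun _ _ => Finset.sum_comm

theorem trace_mul_transpose_ofChoi [Fintype D] (J : Matrix (C × D) (C × D) ℂ) (X : Matrix C C ℂ)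
    (Y : Matrix D D ℂ) :
    (Y * (ofChoi J X)ᵀ).trace = (Xᵀ * ofChoi (J.submatrix Prod.swap Prod.swap) Y).trace := by
  simp only [trace, diag_apply, ofChoi_apply, mul_apply, transpose_apply, submatrix_apply,
    Prod.swap, Finset.mul_sum]
  conv_rhs => rw [Finset.sum_comm]
  rw [Finset.sum_comm_cycle]
  refine Finset.sum_congr rfl fun c _ => Finset.sum_comm_cycle.trans ?_
  simp only [mul_left_comm]

theorem ampliate_ofChoi_nonneg [Finite D] [Finite R] {J : Matrix (C × D) (C × D) ℂ} (hJ : 0 ≤ J)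
    {X : Matrix (R × C) (R × C) ℂ} (hX : 0 ≤ X) : 0 ≤ ampliate (ofChoi J) X :=
  (sum_blocks_nonneg <| nonneg_submatrix (nonneg_kronecker hX hJ)
    fun y : (R × D) × C => ((y.1.1, y.2), (y.2, y.1.2))).trans_eq <| by
      ext
      simp [ampliate, ofChoi_apply]

theorem ofChoi_nonneg [Finite D] {J : Matrix (C × D) (C × D) ℂ} (hJ : 0 ≤ J) {X : Matrix C C ℂ}
    (hX : 0 ≤ X) : 0 ≤ ofChoi J X :=
  nonneg_submatrix (ampliate_ofChoi_nonneg (R := Unit) hJ (nonneg_submatrix hX Prod.snd))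
    fun p : D => ((), p)

variable [DecidableEq C]

theorem choi_ofChoi (J : Matrix (C × D) (C × D) ℂ) : choi (ofChoi J) = J := by
  ext ⟨c, p⟩ ⟨c', q⟩
  rw [choi_apply, ofChoi_apply]
  simp [single_apply, ite_and]

theorem ofChoi_choi (Φ : Matrix C C ℂ →ₗ[ℂ] Matrix D D ℂ) : ofChoi (choi Φ) = Φ := by
  refine LinearMap.ext fun X => ext fun p q => ?_
  conv_rhs => rw [matrix_eq_sum_single X]
  simp only [ofChoi_apply, choi_apply, map_sum, Matrix.sum_apply]
  refine Finset.sum_congr rfl fun c _ => Finset.sum_congr rfl fun c' _ => ?_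
  have single_eq : single c c' (X c c') = X c c' • single c c' (1 : ℂ) := by
    rw [smul_single, smul_eq_mul, mul_one]
  rw [single_eq, map_smul, Matrix.smul_apply, smul_eq_mul]

end OfChoi

theorem ampliate_nonneg [Finite C] [Finite D] [Finite R]
    {Φ : Matrix C C ℂ →ₗ[ℂ] Matrix D D ℂ} (hΦ : IsCP Φ) {X : Matrix (R × C) (R × C) ℂ}
    (hX : 0 ≤ X) : 0 ≤ ampliate Φ X := by
  classical
  have := Fintype.ofFinite C
  exact ofChoi_choi Φ ▸ ampliate_ofChoi_nonneg (choi_nonneg_of_isCP hΦ) hX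

theorem isCP_iff_choi_nonneg [Finite C] [Finite D] [DecidableEq C]
    {Φ : Matrix C C ℂ →ₗ[ℂ] Matrix D D ℂ} : IsCP Φ ↔ 0 ≤ choi Φ := by
  refine ⟨choi_nonneg_of_isCP, fun hΦ _ _ hX => ?_⟩
  have := Fintype.ofFinite C
  exact ofChoi_choi Φ ▸ ampliate_ofChoi_nonneg hΦ hX

variable [Fintype C] [DecidableEq C]

theorem trace_maxEnt : (maxEnt C).trace = Fintype.card C := by
  simp [trace, maxEnt, Fintype.sum_prod_type]

variable [Fintype D]

theorem trace_apply_eq_trace_iff {Φ : Matrix C C ℂ →ₗ[ℂ] Matrix D D ℂ} :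
    (∀ X, (Φ X).trace = X.trace) ↔ partialTrace₂ (choi Φ) = 1 := by
  refine ⟨fun hΦ => ?_, fun hΦ X => ?_⟩
  · ext c c'
    have trace_block : partialTrace₂ (choi Φ) c c' = (Φ (single c c' 1)).trace := by
      simp [partialTrace₂, choi_apply, trace]
    rw [trace_block, hΦ, one_apply]
    split_ifs with hc
    · rw [hc, trace_single_eq_same]
    · exact trace_single_eq_of_ne c c' 1 hc
  · conv_lhs => rw [← ofChoi_choi Φ]
    rw [trace_ofChoi, hΦ, Matrix.mul_one, trace_transpose]

theorem isChannel_iff {Φ : Matrix C C ℂ →ₗ[ℂ] Matrix D D ℂ} :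
    IsChannel Φ ↔ 0 ≤ choi Φ ∧ partialTrace₂ (choi Φ) = 1 := by
  rw [IsChannel, isCP_iff_choi_nonneg, trace_apply_eq_trace_iff]

end Choi

section DiamondDist

variable {C D R : Type*} [Fintype C] [Fintype D] [Fintype R]

theorem trace_ampliate {Φ : Matrix C C ℂ →ₗ[ℂ] Matrix D D ℂ} (hΦ : ∀ X, (Φ X).trace = X.trace)
    (X : Matrix (R × C) (R × C) ℂ) : (ampliate Φ X).trace = X.trace := by
  have trace_block (r : R) : ∑ p, ampliate Φ X (r, p) (r, p) = ∑ c, X (r, c) (r, c) :=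
    hΦ (of fun c c' => X (r, c) (r, c'))
  simp only [trace, diag_apply, Fintype.sum_prod_type, trace_block]

variable [DecidableEq D] [DecidableEq R] {N M : Matrix C C ℂ →ₗ[ℂ] Matrix D D ℂ}

theorem bddAbove_diamondDist (hN : IsChannel N) (hM : IsChannel M) :
    BddAbove {t : ℝ | ∃ (r : ℕ) (ρ : Matrix (Fin r × C) (Fin r × C) ℂ),
      IsState ρ ∧ t = traceNorm (ampliate N ρ - ampliate M ρ)} := by
  refine ⟨2, ?_⟩
  rintro t ⟨r, ρ, hρ, rfl⟩
  refine (traceNorm_sub_le (ampliate_nonneg hN.1 hρ.1) (ampliate_nonneg hM.1 hρ.1)).trans ?_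
  rw [trace_ampliate hN.2, trace_ampliate hM.2, hρ.2]
  norm_num

theorem traceNorm_ampliate_sub_le_diamondDist (hN : IsChannel N) (hM : IsChannel M)
    {ρ : Matrix (R × C) (R × C) ℂ} (hρ : IsState ρ) :
    traceNorm (ampliate N ρ - ampliate M ρ) ≤ diamondDist N M := by
  let e := (Fintype.equivFin R).symm
  let eC := e.prodCongr (Equiv.refl C)
  let eD := e.prodCongr (Equiv.refl D)
  have hρ' : IsState (ρ.submatrix eC eC) :=
    ⟨nonneg_submatrix hρ.1 _, (trace_submatrix_equiv ρ eC).trans hρ.2⟩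
  refine le_csSup (bddAbove_diamondDist hN hM) ⟨_, _, hρ', ?_⟩
  exact (traceNorm_submatrix_equiv (ampliate N ρ - ampliate M ρ) eD).symm

theorem two_mul_trace_le_diamondDist (hN : IsChannel N) (hM : IsChannel M)
    {ρ : Matrix (R × C) (R × C) ℂ} (hρ : IsState ρ) {W : Matrix (R × D) (R × D) ℂ} (hW : 0 ≤ W)
    (hW1 : W ≤ 1) : 2 * (W * (ampliate N ρ - ampliate M ρ)).trace.re ≤ diamondDist N M := by
  have hermitian : (ampliate N ρ - ampliate M ρ).IsHermitian :=
    (nonneg_iff_posSemidef.1 (ampliate_nonneg hN.1 hρ.1)).isHermitian.sub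
      (nonneg_iff_posSemidef.1 (ampliate_nonneg hM.1 hρ.1)).isHermitian
  have traceless : (ampliate N ρ - ampliate M ρ).trace = 0 := by
    rw [trace_sub, trace_ampliate hN.2, trace_ampliate hM.2, sub_self]
  refine le_trans ?_ (traceNorm_ampliate_sub_le_diamondDist hN hM hρ)
  simpa [traceless] using two_mul_trace_sub_le_traceNorm hermitian hW hW1

theorem diamondDist_le_of_smul_choi_le [DecidableEq C] (hN : IsChannel N) (hM : IsChannel M)
    {k : ℝ} (hk : k ≤ 1) (hkN : k • choi N ≤ choi M) : diamondDist N M ≤ 2 * (1 - k) := by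
  refine Real.sSup_le ?_ (by linarith)
  rintro t ⟨r, ρ, hρ, rfl⟩
  -- Both channels share the part `k N`, so only the parts `(1 - k) N` and `M - k N` differ.
  have ampliate_rest : ampliate (M - (k : ℂ) • N) ρ = ampliate M ρ - k • ampliate N ρ := by
    ext
    simp [ampliate]
  have isCP_rest : IsCP (M - (k : ℂ) • N) := by
    have choi_rest : choi (M - (k : ℂ) • N) = choi M - k • choi N := by
      ext
      simp [choi_apply]
    exact isCP_iff_choi_nonneg.2 (choi_rest ▸ sub_nonneg.2 hkN)
  have ampliate_sub : ampliate N ρ - ampliate M ρ =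
      (1 - k) • ampliate N ρ - ampliate (M - (k : ℂ) • N) ρ := by
    rw [ampliate_rest]
    module
  calc traceNorm (ampliate N ρ - ampliate M ρ)
      ≤ ((1 - k) • ampliate N ρ).trace.re + (ampliate (M - (k : ℂ) • N) ρ).trace.re :=
        ampliate_sub ▸ traceNorm_sub_le
          (smul_nonneg (sub_nonneg.2 hk) (ampliate_nonneg hN.1 hρ.1))
          (ampliate_nonneg isCP_rest hρ.1)
    _ = 2 * (1 - k) := by
        simp only [ampliate_rest, trace_sub, trace_smul, trace_ampliate hN.2, trace_ampliate hM.2,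
          hρ.2, Complex.sub_re, Complex.smul_re, Complex.one_re, smul_eq_mul]
        ring

end DiamondDist

section MaxEntProj

variable (C : Type*) [Fintype C] [DecidableEq C]

/-- The maximally entangled state, as a rank-one projection. -/
noncomputable def maxEntProj : Matrix (C × C) (C × C) ℂ := (Fintype.card C : ℝ)⁻¹ • maxEnt C

theorem isState_maxEntProj [Nonempty C] : IsState (maxEntProj C) := by
  refine ⟨smul_nonneg (by positivity) maxEnt_nonneg, ?_⟩
  rw [maxEntProj, trace_smul, trace_maxEnt]
  simp

variable {C}

theorem ampliate_maxEntProj {D : Type*} (Φ : Matrix C C ℂ →ₗ[ℂ] Matrix D D ℂ) :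
    ampliate Φ (maxEntProj C) = (Fintype.card C : ℝ)⁻¹ • choi Φ := by
  ext p q
  have block_smul : (of fun c c' => maxEntProj C (p.1, c) (q.1, c')) =
      (Fintype.card C : ℝ)⁻¹ • of fun c c' => maxEnt C (p.1, c) (q.1, c') := rfl
  rw [ampliate, of_apply, block_smul, LinearMap.map_smul_of_tower]
  rfl

end MaxEntProj

section Simulation

variable {A B A' B' Ahat Bhat : Type*}

theorem partialTranspose₂_apply (X : Matrix (A × B) (A × B) ℂ) (p q : A × B) :
    partialTranspose₂ X p q = X (p.1, q.2) (q.1, p.2) := rfl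

variable [DecidableEq A] [DecidableEq B]

theorem bobTranspose_choi (P : Matrix (A × B) (A × B) ℂ →ₗ[ℂ] Matrix (A' × B') (A' × B') ℂ) :
    bobTranspose (choi P) = choi (partialTranspose₂ ∘ₗ P ∘ₗ partialTranspose₂) := by
  ext ⟨⟨a, b⟩, ⟨a', b'⟩⟩ ⟨⟨e, f⟩, ⟨e', f'⟩⟩
  have partialTranspose_single : partialTranspose₂ (single (a, b) (e, f) (1 : ℂ)) =
      single (a, f) (e, b) 1 := by
    ext ⟨x, y⟩ ⟨z, w⟩
    simp only [partialTranspose₂_apply, single_apply, Prod.mk.injEq]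
    exact if_congr (by tauto) rfl rfl
  rw [choi_apply, LinearMap.comp_apply, LinearMap.comp_apply, partialTranspose_single]
  exact choi_apply P _ _

variable [Fintype A] [Fintype B] [Fintype A'] [Fintype B']

/-- The Choi operators of the C-PPT-P channels from `A ⊗ B` to `A' ⊗ B'`. -/
structure IsPPTChoi (J : Matrix ((A × B) × (A' × B')) ((A × B) × (A' × B')) ℂ) : Prop where
  nonneg : 0 ≤ J
  ppt : 0 ≤ bobTranspose J
  trace_eq : partialTrace₂ J = 1

theorem isPPTChoi_choi_iff {P : Matrix (A × B) (A × B) ℂ →ₗ[ℂ] Matrix (A' × B') (A' × B') ℂ} :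
    IsPPTChoi (choi P) ↔ IsChannel P ∧ IsCPPTP P := by
  rw [isChannel_iff, IsCPPTP, isCP_iff_choi_nonneg, ← bobTranspose_choi]
  exact ⟨fun h => ⟨⟨h.nonneg, h.trace_eq⟩, h.ppt⟩, fun h => ⟨h.1.1, h.2, h.1.2⟩⟩

variable [DecidableEq A'] [DecidableEq B'] [Fintype Ahat] [Fintype Bhat]

theorem contractResource_eq_ofChoi (ρ : Matrix (Ahat × Bhat) (Ahat × Bhat) ℂ)
    (J : Matrix (((A × Ahat) × (B × Bhat)) × (A' × B')) (((A × Ahat) × (B × Bhat)) × (A' × B')) ℂ) :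
    contractResource ρ J = ofChoi (J.submatrix
      (fun z => (resourceLast A B A' B' Ahat Bhat).symm z.swap)
      (fun z => (resourceLast A B A' B' Ahat Bhat).symm z.swap)) ρ := by
  ext x y
  rw [contractResource, partialTrace₂, of_apply, ofChoi_apply, Finset.sum_comm]
  refine Finset.sum_congr rfl fun h _ => ?_
  rw [mul_apply, Fintype.sum_prod_type, Finset.sum_eq_single x]
  · simp
  · intro z _ hz
    simp [hz.symm]
  · simp

theorem contractResource_add (ρ : Matrix (Ahat × Bhat) (Ahat × Bhat) ℂ)
    (J J' : Matrix (((A × Ahat) × (B × Bhat)) × (A' × B'))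
      (((A × Ahat) × (B × Bhat)) × (A' × B')) ℂ) :
    contractResource ρ (J + J') = contractResource ρ J + contractResource ρ J' := by
  simp only [contractResource_eq_ofChoi, submatrix_add, Pi.add_apply, map_add, LinearMap.add_apply]

variable [DecidableEq Ahat] [DecidableEq Bhat]

theorem choi_simulate
    (P : Matrix ((A × Ahat) × (B × Bhat)) ((A × Ahat) × (B × Bhat)) ℂ →ₗ[ℂ]
      Matrix (A' × B') (A' × B') ℂ) (ρ : Matrix (Ahat × Bhat) (Ahat × Bhat) ℂ) :
    choi (simulate P ρ) = contractResource ρ (choi P) := by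
  let e := Equiv.prodProdProdComm A B Ahat Bhat
  ext ⟨x, p⟩ ⟨y, q⟩
  rw [choi_apply, contractResource_eq_ofChoi, ofChoi_apply]
  have input_eq : (single x y (1 : ℂ) ⊗ₖ ρ).reindex e e =
      ∑ h, ∑ k, ρ h k • single (e (x, h)) (e (y, k)) (1 : ℂ) := by
    ext u v
    obtain ⟨⟨x', h'⟩, rfl⟩ := e.surjective u
    obtain ⟨⟨y', k'⟩, rfl⟩ := e.surjective v
    simp [Matrix.sum_apply, single_apply, ite_and]
  change P ((single x y (1 : ℂ) ⊗ₖ ρ).reindex e e) p q = _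
  simp only [input_eq, map_sum, map_smul, Matrix.sum_apply, Matrix.smul_apply, smul_eq_mul,
    submatrix_apply, choi_apply]
  rfl

end Simulation

section SimulationError

variable {A B A' B' Ahat Bhat : Type*} [Fintype A] [Fintype B] [Fintype A'] [Fintype B']
  [Fintype Ahat] [Fintype Bhat] {ρ : Matrix (Ahat × Bhat) (Ahat × Bhat) ℂ}

theorem isChannel_simulate
    {P : Matrix ((A × Ahat) × (B × Bhat)) ((A × Ahat) × (B × Bhat)) ℂ →ₗ[ℂ]
      Matrix (A' × B') (A' × B') ℂ} (hP : IsChannel P) (hρ : IsState ρ) :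
    IsChannel (simulate P ρ) := by
  classical
  refine ⟨isCP_iff_choi_nonneg.2 ?_, fun X => ?_⟩
  · rw [choi_simulate, contractResource_eq_ofChoi]
    exact ofChoi_nonneg (nonneg_submatrix (isChannel_iff.1 hP).1 _) hρ.1
  · rw [simulate, LinearMap.coe_mk, AddHom.coe_mk, hP.2, reindex_apply, trace_submatrix_equiv,
      trace_kronecker, hρ.2, mul_one]

variable [DecidableEq A] [DecidableEq B] [DecidableEq A'] [DecidableEq B'] [DecidableEq Ahat]
  [DecidableEq Bhat]

theorem two_mul_trace_le_diamondDist_simulate [Nonempty (A × B)]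
    {N : Matrix (A × B) (A × B) ℂ →ₗ[ℂ] Matrix (A' × B') (A' × B') ℂ}
    {P : Matrix ((A × Ahat) × (B × Bhat)) ((A × Ahat) × (B × Bhat)) ℂ →ₗ[ℂ]
      Matrix (A' × B') (A' × B') ℂ} (hN : IsChannel N) (hP : IsChannel P) (hρ : IsState ρ)
    {W : Matrix ((A × B) × (A' × B')) ((A × B) × (A' × B')) ℂ} (hW : 0 ≤ W) (hW1 : W ≤ 1) :
    2 * ((Fintype.card (A × B) : ℝ)⁻¹ *
      (W * (choi N - contractResource ρ (choi P))).trace.re) ≤ diamondDist N (simulate P ρ) := by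
  have key := two_mul_trace_le_diamondDist hN (isChannel_simulate hP hρ)
    (isState_maxEntProj (A × B)) hW hW1
  rwa [ampliate_maxEntProj, ampliate_maxEntProj, choi_simulate, ← smul_sub, Matrix.mul_smul,
    trace_smul, Complex.smul_re, smul_eq_mul] at key

theorem isSimFeasible_of_smul_choi_le
    {N : Matrix (A × B) (A × B) ℂ →ₗ[ℂ] Matrix (A' × B') (A' × B') ℂ} (hN : IsChannel N)
    {J : Matrix (((A × Ahat) × (B × Bhat)) × (A' × B')) (((A × Ahat) × (B × Bhat)) × (A' × B')) ℂ}
    (hJ : IsPPTChoi J) {k : ℝ} (hk : k ≤ 1) (hkN : k • choi N ≤ contractResource ρ J) :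
    IsSimFeasible N ρ (1 - k) ((1 - k) • choi N) J where
  mu_nonneg := sub_nonneg.2 hk
  Z_nonneg := smul_nonneg (sub_nonneg.2 hk) (isChannel_iff.1 hN).1
  P_nonneg := hJ.nonneg
  le_mu := by
    have partialTrace_smul : partialTrace₂ ((1 - k) • choi N) =
        (1 - k) • partialTrace₂ (choi N) := by
      ext
      simp [partialTrace₂, Finset.mul_sum]
    rw [partialTrace_smul, (isChannel_iff.1 hN).2]
  ppt := hJ.ppt
  trace_eq := hJ.trace_eq
  le_Z := by
    rw [sub_smul, one_smul]
    exact sub_le_sub_left hkN _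

theorem IsSimFeasible.trace_mul_le {N : Matrix (A × B) (A × B) ℂ →ₗ[ℂ] Matrix (A' × B') (A' × B') ℂ}
    {μ : ℝ} {Z : Matrix ((A × B) × (A' × B')) ((A × B) × (A' × B')) ℂ}
    {J : Matrix (((A × Ahat) × (B × Bhat)) × (A' × B')) (((A × Ahat) × (B × Bhat)) × (A' × B')) ℂ}
    (h : IsSimFeasible N ρ μ Z J) {W : Matrix ((A × B) × (A' × B')) ((A × B) × (A' × B')) ℂ}
    (hW : 0 ≤ W) (hW1 : W ≤ 1) :
    (W * (choi N - contractResource ρ J)).trace.re ≤ μ * Fintype.card (A × B) := by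
  have test_le_Z := trace_mul_re_nonneg hW (sub_nonneg.2 h.le_Z)
  have test_le_one := trace_mul_re_nonneg (sub_nonneg.2 hW1) h.Z_nonneg
  have trace_Z_le := trace_re_nonneg (sub_nonneg.2 h.le_mu)
  have trace_partialTrace : (partialTrace₂ Z).trace = Z.trace :=
    (Fintype.sum_prod_type fun x => Z x x).symm
  simp only [Matrix.mul_sub, Matrix.sub_mul, Matrix.one_mul, trace_sub, Complex.sub_re,
    trace_partialTrace, trace_smul, trace_one, Complex.smul_re, Complex.natCast_re,
    smul_eq_mul] at *
  linarith

end SimulationError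

section Legs

variable {A B A' B' Ahat Bhat : Type*}

/-- The regrouping of the systems of a Choi operator into the two legs `A → B'` and `B → A'` of the
swap, followed by the resource. -/
def legs (A B A' B' Ahat Bhat : Type*) :
    ((A × Ahat) × (B × Bhat)) × (A' × B') ≃ ((A × B') × (B × A')) × (Ahat × Bhat) where
  toFun x := (((x.1.1.1, x.2.2), (x.1.2.1, x.2.1)), (x.1.1.2, x.1.2.2))
  invFun y := (((y.1.1.1, y.2.1), (y.1.2.1, y.2.2)), (y.1.2.2, y.1.1.2))
  left_inv _ := rfl
  right_inv _ := rfl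

/-- The regrouping `legs` in the absence of a resource. -/
def crossLegs (A B A' B' : Type*) : (A × B) × (A' × B') ≃ (A × B') × (B × A') where
  toFun x := ((x.1.1, x.2.2), (x.1.2, x.2.1))
  invFun y := ((y.1.1, y.2.1), (y.2.2, y.1.2))
  left_inv _ := rfl
  right_inv _ := rfl

/-- The Choi operator that acts on the two legs as `W₁` and `W₂` and tests the resource with `Y`.
The transpose of `Y` compensates for the one in `contractResource`. -/
def legChoi (W₁ : Matrix (A × B') (A × B') ℂ) (W₂ : Matrix (B × A') (B × A') ℂ)
    (Y : Matrix (Ahat × Bhat) (Ahat × Bhat) ℂ) :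
    Matrix (((A × Ahat) × (B × Bhat)) × (A' × B')) (((A × Ahat) × (B × Bhat)) × (A' × B')) ℂ :=
  ((W₁ ⊗ₖ W₂) ⊗ₖ Yᵀ).submatrix (legs A B A' B' Ahat Bhat) (legs A B A' B' Ahat Bhat)

theorem bobTranspose_legChoi (W₁ : Matrix (A × B') (A × B') ℂ) (W₂ : Matrix (B × A') (B × A') ℂ)
    (Y : Matrix (Ahat × Bhat) (Ahat × Bhat) ℂ) :
    bobTranspose (legChoi W₁ W₂ Y) =
      legChoi (partialTranspose₂ W₁) (partialTranspose₂ W₂)ᵀ (partialTranspose₂ Y) := rfl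

theorem partialTrace₂_legChoi [Fintype A'] [Fintype B'] (W₁ : Matrix (A × B') (A × B') ℂ)
    (W₂ : Matrix (B × A') (B × A') ℂ) (Y : Matrix (Ahat × Bhat) (Ahat × Bhat) ℂ) :
    partialTrace₂ (legChoi W₁ W₂ Y) = ((partialTrace₂ W₁ ⊗ₖ partialTrace₂ W₂) ⊗ₖ Yᵀ).submatrix
      (Equiv.prodProdProdComm A Ahat B Bhat) (Equiv.prodProdProdComm A Ahat B Bhat) := by
  ext p q
  simp only [partialTrace₂, legChoi, legs, Equiv.coe_fn_mk, submatrix_apply, kroneckerMap_apply,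
    transpose_apply, Fintype.sum_prod_type_right, of_apply, Equiv.prodProdProdComm_apply,
    Finset.mul_sum, Finset.sum_mul]
  exact Finset.sum_comm

theorem legChoi_nonneg [Finite A] [Finite B] [Finite A'] [Finite B'] [Finite Ahat] [Finite Bhat]
    {W₁ : Matrix (A × B') (A × B') ℂ} {W₂ : Matrix (B × A') (B × A') ℂ}
    {Y : Matrix (Ahat × Bhat) (Ahat × Bhat) ℂ} (hW₁ : 0 ≤ W₁) (hW₂ : 0 ≤ W₂) (hY : 0 ≤ Y) :
    0 ≤ legChoi W₁ W₂ Y :=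
  nonneg_submatrix (nonneg_kronecker (nonneg_kronecker hW₁ hW₂) (nonneg_transpose hY)) _

variable [Fintype A] [Fintype B] [Fintype A'] [Fintype B']

/-- The effect on the resource that corresponds to applying the tests `W₁` and `W₂` to the two legs
of the normalized Choi operator `J`. -/
noncomputable def legEffect
    (J : Matrix (((A × Ahat) × (B × Bhat)) × (A' × B')) (((A × Ahat) × (B × Bhat)) × (A' × B')) ℂ) :
    Matrix (A × B') (A × B') ℂ →ₗ[ℂ] Matrix (B × A') (B × A') ℂ →ₗ[ℂ]
      Matrix (Ahat × Bhat) (Ahat × Bhat) ℂ :=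
  (Fintype.card (A × B) : ℝ)⁻¹ • (kroneckerBilinear (R := ℂ)).compr₂
    ((transposeLinearEquiv (Ahat × Bhat) (Ahat × Bhat) ℂ ℂ).toLinearMap ∘ₗ
      ofChoi (J.submatrix (legs A B A' B' Ahat Bhat).symm (legs A B A' B' Ahat Bhat).symm))

variable
  (J : Matrix (((A × Ahat) × (B × Bhat)) × (A' × B')) (((A × Ahat) × (B × Bhat)) × (A' × B')) ℂ)
  (W₁ : Matrix (A × B') (A × B') ℂ) (W₂ : Matrix (B × A') (B × A') ℂ)

theorem legEffect_eq : legEffect J W₁ W₂ = (Fintype.card (A × B) : ℝ)⁻¹ •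
    (ofChoi (J.submatrix (legs A B A' B' Ahat Bhat).symm (legs A B A' B' Ahat Bhat).symm)
      (W₁ ⊗ₖ W₂))ᵀ := rfl

theorem partialTranspose₂_legEffect : partialTranspose₂ (legEffect J W₁ W₂) =
    legEffect (bobTranspose J) (partialTranspose₂ W₁) (partialTranspose₂ W₂)ᵀ := by
  ext ⟨x, y⟩ ⟨z, w⟩
  rw [legEffect_eq, legEffect_eq, partialTranspose₂_apply,
    Matrix.smul_apply, Matrix.smul_apply, transpose_apply, transpose_apply, ofChoi_apply,
    ofChoi_apply, ← Fintype.sum_prod_type', ← Fintype.sum_prod_type']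
  congr 1
  -- Transposing `B` and `B'` exchanges these indices between the row and the column.
  let exchange (z : ((A × B') × (B × A')) × ((A × B') × (B × A'))) :
      ((A × B') × (B × A')) × ((A × B') × (B × A')) :=
    (((z.1.1.1, z.2.1.2), (z.2.2.1, z.1.2.2)), ((z.2.1.1, z.1.1.2), (z.1.2.1, z.2.2.2)))
  exact Fintype.sum_equiv ⟨exchange, exchange, fun _ => rfl, fun _ => rfl⟩ _ _ fun _ => rfl

variable {J W₁ W₂}

theorem legEffect_one_one [DecidableEq A] [DecidableEq B] [DecidableEq A'] [DecidableEq B']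
    [DecidableEq Ahat] [DecidableEq Bhat] [Nonempty (A × B)] (hJ : partialTrace₂ J = 1) :
    legEffect J 1 1 = 1 := by
  have card_ne_zero : (Fintype.card (A × B) : ℝ) ≠ 0 := Nat.cast_ne_zero.2 Fintype.card_ne_zero
  rw [legEffect_eq, inv_smul_eq_iff₀ card_ne_zero, one_kronecker_one]
  ext h k
  have marginal (z : A × B) :
      ∑ x, J (((z.1, k.1), (z.2, k.2)), x) (((z.1, h.1), (z.2, h.2)), x) =
        (1 : Matrix (Ahat × Bhat) (Ahat × Bhat) ℂ) h k :=
    (congrFun₂ hJ ((z.1, k.1), (z.2, k.2)) ((z.1, h.1), (z.2, h.2))).trans <| by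
      simp [one_apply, Prod.ext_iff, eq_comm]
  calc (ofChoi (J.submatrix (legs A B A' B' Ahat Bhat).symm (legs A B A' B' Ahat Bhat).symm) 1)ᵀ h k
      = ∑ c, J ((legs A B A' B' Ahat Bhat).symm (c, k))
          ((legs A B A' B' Ahat Bhat).symm (c, h)) := by
        simp [ofChoi_apply, one_apply]
    _ = ∑ z : A × B, ∑ x, J (((z.1, k.1), (z.2, k.2)), x) (((z.1, h.1), (z.2, h.2)), x) := by
        rw [← (crossLegs A B A' B').sum_comp, Fintype.sum_prod_type]
        rfl
    _ = ((Fintype.card (A × B) : ℝ) • (1 : Matrix (Ahat × Bhat) (Ahat × Bhat) ℂ)) h k := by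
        simp only [marginal, Finset.sum_const, Finset.card_univ, Matrix.smul_apply,
          Nat.cast_smul_eq_nsmul]

theorem legEffect_nonneg [Finite Ahat] [Finite Bhat] (hJ : 0 ≤ J) (hW₁ : 0 ≤ W₁)
    (hW₂ : 0 ≤ W₂) : 0 ≤ legEffect J W₁ W₂ := by
  have := Fintype.ofFinite Ahat
  have := Fintype.ofFinite Bhat
  rw [legEffect_eq]
  exact smul_nonneg (by positivity) <| nonneg_transpose <|
    ofChoi_nonneg (nonneg_submatrix hJ _) (nonneg_kronecker hW₁ hW₂)

variable [DecidableEq A] [DecidableEq B]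

theorem partialTranspose₂_legEffect_nonneg [Finite Ahat] [Finite Bhat] [DecidableEq Ahat]
    [DecidableEq Bhat] (hJ : IsPPTChoi J) (hW₁ : 0 ≤ partialTranspose₂ W₁)
    (hW₂ : 0 ≤ partialTranspose₂ W₂) : 0 ≤ partialTranspose₂ (legEffect J W₁ W₂) :=
  partialTranspose₂_legEffect J W₁ W₂ ▸ legEffect_nonneg hJ.ppt hW₁ (nonneg_transpose hW₂)

variable [DecidableEq A'] [DecidableEq B'] [Fintype Ahat] [Fintype Bhat]

theorem trace_mul_legEffect (ρ : Matrix (Ahat × Bhat) (Ahat × Bhat) ℂ) :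
    (ρ * legEffect J W₁ W₂).trace = (Fintype.card (A × B) : ℝ)⁻¹ •
      (((W₁ᵀ ⊗ₖ W₂ᵀ).submatrix (crossLegs A B A' B') (crossLegs A B A' B')) *
        contractResource ρ J).trace := by
  have contract_eq : contractResource ρ J =
      (ofChoi ((J.submatrix (legs A B A' B' Ahat Bhat).symm
        (legs A B A' B' Ahat Bhat).symm).submatrix Prod.swap Prod.swap) ρ).submatrix
          (crossLegs A B A' B') (crossLegs A B A' B') :=
    contractResource_eq_ofChoi ρ J
  rw [legEffect_eq, Matrix.mul_smul, trace_smul, trace_mul_transpose_ofChoi, contract_eq,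
    submatrix_mul_equiv, trace_submatrix_equiv, kroneckerMap_transpose]

theorem contractResource_legChoi (ρ Y : Matrix (Ahat × Bhat) (Ahat × Bhat) ℂ)
    (W₁ : Matrix (A × B') (A × B') ℂ) (W₂ : Matrix (B × A') (B × A') ℂ) :
    contractResource ρ (legChoi W₁ W₂ Y) =
      (ρ * Y).trace • (W₁ ⊗ₖ W₂).submatrix (crossLegs A B A' B') (crossLegs A B A' B') := by
  ext x y
  rw [contractResource_eq_ofChoi, ofChoi_apply]
  simp [legChoi, legs, crossLegs, resourceLast, trace, mul_apply, Finset.sum_mul, mul_assoc,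
    mul_comm (Y _ _)]

end Legs

section Projections

theorem partialTranspose₂_one {C D : Type*} [DecidableEq C] [DecidableEq D] :
    partialTranspose₂ (1 : Matrix (C × D) (C × D) ℂ) = 1 := by
  ext p q
  simp only [partialTranspose₂_apply, one_apply, Prod.ext_iff, eq_comm (a := p.2)]

variable (C : Type*) [DecidableEq C]

/-- The operator that exchanges the two factors of `C ⊗ C`. -/
def flipOp : Matrix (C × C) (C × C) ℂ := Equiv.Perm.permMatrix ℂ (Equiv.prodComm C C)

theorem conjTranspose_flipOp : (flipOp C)ᴴ = flipOp C :=
  conjTranspose_permMatrix (σ := Equiv.prodComm C C)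

/-- The projection onto the symmetric subspace of `C ⊗ C`. -/
noncomputable def symProj : Matrix (C × C) (C × C) ℂ := (2 : ℝ)⁻¹ • (1 + flipOp C)

theorem transpose_symProj : (symProj C)ᵀ = symProj C := by
  have transpose_flipOp : (flipOp C)ᵀ = flipOp C := transpose_permMatrix (σ := Equiv.prodComm C C)
  rw [symProj, transpose_smul, transpose_add, transpose_one, transpose_flipOp]

theorem partialTranspose₂_maxEnt : partialTranspose₂ (maxEnt C) = symProj C - (1 - symProj C) := by
  have eq_flipOp : partialTranspose₂ (maxEnt C) = flipOp C := by
    ext ⟨a, b⟩ ⟨c, d⟩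
    simp [partialTranspose₂_apply, maxEnt, flipOp, PEquiv.toMatrix_apply, ← ite_and, and_comm,
      eq_comm]
  rw [eq_flipOp, symProj]
  module

variable [Fintype C]

theorem flipOp_mul_self : flipOp C * flipOp C = 1 :=
  (permMatrix_mul ..).symm.trans permMatrix_one

theorem isStarProjection_symProj : IsStarProjection (symProj C) where
  isIdempotentElem := by
    rw [IsIdempotentElem, symProj, smul_mul_smul_comm, Matrix.mul_add, Matrix.add_mul,
      Matrix.add_mul, flipOp_mul_self]
    simp only [Matrix.one_mul, Matrix.mul_one]
    module
  isSelfAdjoint := by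
    rw [isSelfAdjoint_iff, symProj, star_smul, star_add, star_one, star_eq_conjTranspose,
      conjTranspose_flipOp, star_trivial]

theorem maxEnt_mul_self : maxEnt C * maxEnt C = (Fintype.card C : ℝ) • maxEnt C := by
  ext p q
  simp [maxEnt, mul_apply, Fintype.sum_prod_type]

theorem partialTrace₂_maxEnt : partialTrace₂ (maxEnt C) = 1 := by
  ext c c'
  simp [partialTrace₂, maxEnt, one_apply]

theorem transpose_maxEntProj : (maxEntProj C)ᵀ = maxEntProj C := by
  ext p q
  simp only [maxEntProj, maxEnt, transpose_apply, Matrix.smul_apply, of_apply, mul_comm]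

theorem isStarProjection_maxEntProj [Nonempty C] : IsStarProjection (maxEntProj C) where
  isIdempotentElem := by
    rw [IsIdempotentElem, maxEntProj, smul_mul_smul_comm, maxEnt_mul_self, smul_smul,
      inv_mul_cancel_right₀ (Nat.cast_ne_zero.2 Fintype.card_ne_zero)]
  isSelfAdjoint := .of_nonneg (isState_maxEntProj C).1

/-- The complement of `maxEntProj`, scaled to have partial trace one: a Choi operator. -/
noncomputable def maxEntCompl : Matrix (C × C) (C × C) ℂ :=
  ((Fintype.card C : ℝ) / ((Fintype.card C : ℝ) ^ 2 - 1)) • (1 - maxEntProj C)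

variable [Nontrivial C]

theorem maxEntCompl_nonneg : 0 ≤ maxEntCompl C := by
  have one_lt_card : (1 : ℝ) < Fintype.card C := Nat.one_lt_cast.2 Fintype.one_lt_card
  exact smul_nonneg (div_nonneg (by linarith) (by nlinarith))
    (isStarProjection_maxEntProj C).one_sub.nonneg

theorem partialTrace₂_maxEntCompl : partialTrace₂ (maxEntCompl C) = 1 := by
  have one_lt_card : (1 : ℝ) < Fintype.card C := Nat.one_lt_cast.2 Fintype.one_lt_card
  have card_sq_ne : (Fintype.card C : ℝ) ^ 2 - 1 ≠ 0 := by nlinarith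
  have partialTrace_eq : partialTrace₂ (maxEntCompl C) =
      ((Fintype.card C : ℝ) / ((Fintype.card C : ℝ) ^ 2 - 1)) • ((Fintype.card C : ℝ) • 1 -
        (Fintype.card C : ℝ)⁻¹ • partialTrace₂ (maxEnt C)) := by
    ext c c'
    simp [maxEntCompl, maxEntProj, partialTrace₂, one_apply, ← Finset.mul_sum]
  rw [partialTrace_eq, partialTrace₂_maxEnt]
  match_scalars
  field_simp

theorem partialTranspose₂_maxEntCompl : partialTranspose₂ (maxEntCompl C) =
    (1 / ((Fintype.card C : ℝ) + 1)) • symProj C +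
      (1 / ((Fintype.card C : ℝ) - 1)) • (1 - symProj C) := by
  have one_lt_card : (1 : ℝ) < Fintype.card C := Nat.one_lt_cast.2 Fintype.one_lt_card
  have card_add_ne : (Fintype.card C : ℝ) + 1 ≠ 0 := by positivity
  have card_sub_ne : (Fintype.card C : ℝ) - 1 ≠ 0 := by linarith
  have card_sq_ne : (Fintype.card C : ℝ) ^ 2 - 1 ≠ 0 := by nlinarith
  rw [maxEntCompl, maxEntProj, LinearMap.map_smul_of_tower, map_sub, LinearMap.map_smul_of_tower,
    partialTranspose₂_one, partialTranspose₂_maxEnt]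
  match_scalars <;> field_simp <;> ring

theorem partialTranspose₂_maxEntProj_add_nonneg : 0 ≤ partialTranspose₂
    (maxEntProj C + (1 / ((Fintype.card C : ℝ) + 1)) • (1 - maxEntProj C)) := by
  have eq_smul_symProj :
      partialTranspose₂ (maxEntProj C + (1 / ((Fintype.card C : ℝ) + 1)) • (1 - maxEntProj C)) =
        (2 / ((Fintype.card C : ℝ) + 1)) • symProj C := by
    rw [maxEntProj, map_add, LinearMap.map_smul_of_tower, LinearMap.map_smul_of_tower, map_sub,
      LinearMap.map_smul_of_tower, partialTranspose₂_one, partialTranspose₂_maxEnt]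
    match_scalars <;> field_simp <;> ring
  rw [eq_smul_symProj]
  exact smul_nonneg (by positivity) (isStarProjection_symProj C).nonneg

theorem partialTranspose₂_smul_sub_maxEntProj_nonneg : 0 ≤ partialTranspose₂
    ((1 / ((Fintype.card C : ℝ) - 1)) • (1 - maxEntProj C) - maxEntProj C) := by
  have card_sub_pos : (0 : ℝ) < Fintype.card C - 1 :=
    sub_pos.2 (Nat.one_lt_cast.2 Fintype.one_lt_card)
  have eq_smul_one_sub :
      partialTranspose₂ ((1 / ((Fintype.card C : ℝ) - 1)) • (1 - maxEntProj C) - maxEntProj C) =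
        (2 / ((Fintype.card C : ℝ) - 1)) • (1 - symProj C) := by
    rw [maxEntProj, map_sub, LinearMap.map_smul_of_tower, LinearMap.map_smul_of_tower, map_sub,
      LinearMap.map_smul_of_tower, partialTranspose₂_one, partialTranspose₂_maxEnt]
    match_scalars <;> field_simp <;> ring
  rw [eq_smul_one_sub]
  exact smul_nonneg (by positivity) (isStarProjection_symProj C).one_sub.nonneg

end Projections

section Swap

variable {C Ahat Bhat : Type*} [Fintype C] [DecidableEq C]
  {K L M N ρ : Matrix (Ahat × Bhat) (Ahat × Bhat) ℂ}

variable (C) in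
/-- The normalized Choi operator of the swap channel on `C ⊗ C`, as a rank-one projection. -/
noncomputable def swapProj : Matrix ((C × C) × (C × C)) ((C × C) × (C × C)) ℂ :=
  (maxEntProj C ⊗ₖ maxEntProj C).submatrix (crossLegs C C C C) (crossLegs C C C C)

variable (C) in
/-- The Choi operator that measures the resource with the POVM `(K, L, M, N)` and accordingly acts
on each leg as the identity channel or as the channel with Choi operator `maxEntCompl C`. -/
noncomputable def twirledChoi (K L M N : Matrix (Ahat × Bhat) (Ahat × Bhat) ℂ) :
    Matrix (((C × Ahat) × (C × Bhat)) × (C × C)) (((C × Ahat) × (C × Bhat)) × (C × C)) ℂ :=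
  legChoi (maxEnt C) (maxEnt C) K + legChoi (maxEnt C) (maxEntCompl C) L +
    legChoi (maxEntCompl C) (maxEnt C) M + legChoi (maxEntCompl C) (maxEntCompl C) N

theorem partialTrace₂_twirledChoi [DecidableEq Ahat] [DecidableEq Bhat] [Nontrivial C]
    (hsum : K + L + M + N = 1) : partialTrace₂ (twirledChoi C K L M N) = 1 := by
  have partialTrace_add (X Y : Matrix (((C × Ahat) × (C × Bhat)) × (C × C))
      (((C × Ahat) × (C × Bhat)) × (C × C)) ℂ) :
      partialTrace₂ (X + Y) = partialTrace₂ X + partialTrace₂ Y :=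
    Matrix.ext fun _ _ => Finset.sum_add_distrib
  simp only [twirledChoi, partialTrace_add, partialTrace₂_legChoi, partialTrace₂_maxEnt,
    partialTrace₂_maxEntCompl, ← submatrix_add, ← Pi.add_apply, ← kronecker_add, ← transpose_add,
    hsum, transpose_one, one_kronecker_one, submatrix_one_equiv]

theorem bobTranspose_twirledChoi [Nontrivial C] :
    bobTranspose (twirledChoi C K L M N) =
      legChoi (symProj C) (symProj C) (partialTranspose₂ (K + (1 / ((Fintype.card C : ℝ) + 1)) • L +
        (1 / ((Fintype.card C : ℝ) + 1)) • M + (1 / ((Fintype.card C : ℝ) + 1) ^ 2) • N)) +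
      legChoi (symProj C) (1 - symProj C)
        ((1 / ((Fintype.card C : ℝ) - 1)) • partialTranspose₂
            (L + (1 / ((Fintype.card C : ℝ) + 1)) • N) -
          partialTranspose₂ (K + (1 / ((Fintype.card C : ℝ) + 1)) • M)) +
      legChoi (1 - symProj C) (symProj C)
        ((1 / ((Fintype.card C : ℝ) - 1)) • partialTranspose₂
            (M + (1 / ((Fintype.card C : ℝ) + 1)) • N) -
          partialTranspose₂ (K + (1 / ((Fintype.card C : ℝ) + 1)) • L)) +
      legChoi (1 - symProj C) (1 - symProj C)
        (partialTranspose₂ (K + (1 / ((Fintype.card C : ℝ) - 1) ^ 2) • N) -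
          (1 / ((Fintype.card C : ℝ) - 1)) • partialTranspose₂ (L + M)) := by
  have bobTranspose_add (X Y : Matrix (((C × Ahat) × (C × Bhat)) × (C × C))
      (((C × Ahat) × (C × Bhat)) × (C × C)) ℂ) :
      bobTranspose (X + Y) = bobTranspose X + bobTranspose Y := rfl
  simp only [twirledChoi, bobTranspose_add, bobTranspose_legChoi, partialTranspose₂_maxEnt,
    partialTranspose₂_maxEntCompl, transpose_add, transpose_sub, transpose_smul, transpose_one,
    transpose_symProj, ← _root_.one_div_pow]
  generalize 1 - symProj C = A, 1 / ((Fintype.card C : ℝ) + 1) = c,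
    1 / ((Fintype.card C : ℝ) - 1) = e
  ext p q
  simp only [legChoi, Matrix.add_apply, Matrix.sub_apply, Matrix.smul_apply, submatrix_apply,
    kroneckerMap_apply, transpose_apply, map_add, LinearMap.map_smul_of_tower, Complex.real_smul]
  push_cast
  ring

variable (C) in
theorem card_sq_smul_swapProj [Nonempty C] : (Fintype.card C : ℝ) ^ 2 • swapProj C =
    (maxEnt C ⊗ₖ maxEnt C).submatrix (crossLegs C C C C) (crossLegs C C C C) := by
  have maxEnt_eq : maxEnt C = (Fintype.card C : ℝ) • maxEntProj C := by
    rw [maxEntProj, smul_inv_smul₀ (Nat.cast_ne_zero.2 Fintype.card_ne_zero)]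
  rw [maxEnt_eq, smul_kronecker, kronecker_smul, smul_smul, ← sq]
  rfl

variable (C) in
theorem isStarProjection_swapProj [Nonempty C] : IsStarProjection (swapProj C) where
  isIdempotentElem := by
    rw [IsIdempotentElem, swapProj, submatrix_mul_equiv, ← mul_kronecker_mul,
      (isStarProjection_maxEntProj C).isIdempotentElem.eq]
  isSelfAdjoint :=
    .of_nonneg <| nonneg_submatrix
      (nonneg_kronecker (isState_maxEntProj C).1 (isState_maxEntProj C).1) _

variable (C) in
theorem trace_swapProj [Nonempty C] : (swapProj C).trace = 1 := by
  rw [swapProj, trace_submatrix_equiv, trace_kronecker, (isState_maxEntProj C).2, one_mul]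

theorem isPPTChoi_twirledChoi [Finite Ahat] [Finite Bhat] [DecidableEq Ahat]
    [DecidableEq Bhat] [Nontrivial C] (h : IsSwapFeasible (Fintype.card C) K L M N) :
    IsPPTChoi (twirledChoi C K L M N) := by
  have hΦ : 0 ≤ maxEnt C := maxEnt_nonneg
  have hΨ := maxEntCompl_nonneg C
  have hS := (isStarProjection_symProj C).nonneg
  have hS' := (isStarProjection_symProj C).one_sub.nonneg
  refine ⟨?_, ?_, partialTrace₂_twirledChoi h.sum_eq⟩
  · exact add_nonneg (add_nonneg (add_nonneg (legChoi_nonneg hΦ hΦ h.K_nonneg)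
      (legChoi_nonneg hΦ hΨ h.L_nonneg)) (legChoi_nonneg hΨ hΦ h.M_nonneg))
      (legChoi_nonneg hΨ hΨ h.N_nonneg)
  · rw [bobTranspose_twirledChoi]
    exact add_nonneg (add_nonneg (add_nonneg (legChoi_nonneg hS hS h.ppt₁)
      (legChoi_nonneg hS hS' (sub_nonneg.2 h.ppt₂)))
      (legChoi_nonneg hS' hS (sub_nonneg.2 h.ppt₃)))
      (legChoi_nonneg hS' hS' (sub_nonneg.2 h.ppt₄))

theorem isSwapFeasible_legEffect [Finite Ahat] [Finite Bhat] [DecidableEq Ahat]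
    [DecidableEq Bhat] [Nontrivial C]
    {J : Matrix (((C × Ahat) × (C × Bhat)) × (C × C)) (((C × Ahat) × (C × Bhat)) × (C × C)) ℂ}
    (hJ : IsPPTChoi J) : IsSwapFeasible (Fintype.card C)
      (legEffect J (maxEntProj C) (maxEntProj C)) (legEffect J (maxEntProj C) (1 - maxEntProj C))
      (legEffect J (1 - maxEntProj C) (maxEntProj C))
      (legEffect J (1 - maxEntProj C) (1 - maxEntProj C)) := by
  have hP := (isState_maxEntProj C).1
  have hQ := (isStarProjection_maxEntProj C).one_sub.nonneg
  have hadd := partialTranspose₂_maxEntProj_add_nonneg C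
  have hsub := partialTranspose₂_smul_sub_maxEntProj_nonneg C
  have one_eq : maxEntProj C + (1 - maxEntProj C) = 1 := add_sub_cancel ..
  generalize 1 - maxEntProj C = Q at *
  generalize hc : 1 / ((Fintype.card C : ℝ) + 1) = c at hadd
  generalize he : 1 / ((Fintype.card C : ℝ) - 1) = e at hsub
  have ppt₁ := partialTranspose₂_legEffect_nonneg hJ hadd hadd
  have ppt₂ := partialTranspose₂_legEffect_nonneg hJ hadd hsub
  have ppt₃ := partialTranspose₂_legEffect_nonneg hJ hsub hadd
  have ppt₄ := partialTranspose₂_legEffect_nonneg hJ hsub hsub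
  simp only [map_add, map_sub, LinearMap.add_apply, LinearMap.sub_apply,
    LinearMap.map_smul_of_tower, LinearMap.smul_apply] at ppt₁ ppt₂ ppt₃ ppt₄
  constructor
  case K_nonneg => exact legEffect_nonneg hJ.nonneg hP hP
  case L_nonneg => exact legEffect_nonneg hJ.nonneg hP hQ
  case M_nonneg => exact legEffect_nonneg hJ.nonneg hQ hP
  case N_nonneg => exact legEffect_nonneg hJ.nonneg hQ hQ
  case sum_eq =>
    rw [← legEffect_one_one hJ.trace_eq, ← one_eq]
    simp only [map_add, LinearMap.add_apply]
    abel
  all_goals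
    simp only [← _root_.one_div_pow, hc, he, map_add, LinearMap.map_smul_of_tower]
  case ppt₁ => exact ppt₁.trans_eq (by module)
  case ppt₂ => exact sub_nonneg.1 (ppt₂.trans_eq (by module))
  case ppt₃ => exact sub_nonneg.1 (ppt₃.trans_eq (by module))
  case ppt₄ => exact sub_nonneg.1 (ppt₄.trans_eq (by module))

variable [Fintype Ahat] [Fintype Bhat]

theorem trace_mul_legEffect_maxEntProj
    (J : Matrix (((C × Ahat) × (C × Bhat)) × (C × C)) (((C × Ahat) × (C × Bhat)) × (C × C)) ℂ) :
    (ρ * legEffect J (maxEntProj C) (maxEntProj C)).trace =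
      (Fintype.card (C × C) : ℝ)⁻¹ • (swapProj C * contractResource ρ J).trace := by
  rw [trace_mul_legEffect, transpose_maxEntProj, swapProj]

theorem smul_swapProj_le_contractResource_twirledChoi [DecidableEq Ahat] [DecidableEq Bhat]
    [Nontrivial C] (hρ : 0 ≤ ρ) (h : IsSwapFeasible (Fintype.card C) K L M N) :
    (ρ * K).trace.re • (Fintype.card C : ℝ) ^ 2 • swapProj C ≤
      contractResource ρ (twirledChoi C K L M N) := by
  have contract_nonneg {W₁ W₂ : Matrix (C × C) (C × C) ℂ}
      {Y : Matrix (Ahat × Bhat) (Ahat × Bhat) ℂ} (hW₁ : 0 ≤ W₁) (hW₂ : 0 ≤ W₂) (hY : 0 ≤ Y) :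
      0 ≤ contractResource ρ (legChoi W₁ W₂ Y) := by
    rw [contractResource_eq_ofChoi]
    exact ofChoi_nonneg (nonneg_submatrix (legChoi_nonneg hW₁ hW₂ hY) _) hρ
  have hΦ : 0 ≤ maxEnt C := maxEnt_nonneg
  have hΨ := maxEntCompl_nonneg C
  have contract_ideal : contractResource ρ (legChoi (maxEnt C) (maxEnt C) K) =
      (ρ * K).trace.re • (Fintype.card C : ℝ) ^ 2 • swapProj C := by
    have trace_re : ((ρ * K).trace.re : ℂ) = (ρ * K).trace :=
      (Complex.eq_re_of_ofReal_le (trace_mul_nonneg hρ h.K_nonneg)).symm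
    rw [contractResource_legChoi, card_sq_smul_swapProj, ← Complex.coe_smul, trace_re]
  rw [twirledChoi, contractResource_add, contractResource_add, contractResource_add, contract_ideal,
    add_assoc, add_assoc]
  exact le_add_of_nonneg_right <| add_nonneg (contract_nonneg hΦ hΨ h.L_nonneg) <|
    add_nonneg (contract_nonneg hΨ hΦ h.M_nonneg) (contract_nonneg hΨ hΨ h.N_nonneg)

end Swap

section SwapChannel

variable {d : ℕ}

theorem swapOp_eq_flipOp (d : ℕ) : swapOp d = flipOp (Fin d) := by
  ext ⟨a, b⟩ ⟨c, e⟩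
  simp [swapOp, flipOp, Matrix.sum_apply, single_apply, PEquiv.toMatrix_apply, ite_and, and_comm,
    eq_comm]

theorem swapChannel_apply (X : Matrix (Fin d × Fin d) (Fin d × Fin d) ℂ) :
    swapChannel d X = X.submatrix Prod.swap Prod.swap := by
  rw [swapChannel, LinearMap.coe_mk, AddHom.coe_mk, swapOp_eq_flipOp, conjTranspose_flipOp, flipOp,
    Equiv.Perm.permMatrix, PEquiv.toMatrix_toPEquiv_mul, PEquiv.mul_toMatrix_toPEquiv,
    submatrix_submatrix]
  rfl

theorem choi_swapChannel (d : ℕ) : choi (swapChannel d) =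
    (maxEnt (Fin d) ⊗ₖ maxEnt (Fin d)).submatrix (crossLegs _ _ _ _) (crossLegs _ _ _ _) := by
  ext ⟨⟨a, b⟩, ⟨a', b'⟩⟩ ⟨⟨e, f⟩, ⟨e', f'⟩⟩
  rw [choi_apply, swapChannel_apply]
  simp [single_apply, maxEnt, crossLegs, ← ite_and, and_assoc, and_left_comm, and_comm]

theorem isChannel_swapChannel (d : ℕ) : IsChannel (swapChannel d) := by
  refine ⟨isCP_iff_choi_nonneg.2 ?_, fun X => ?_⟩
  · rw [choi_swapChannel]
    exact nonneg_submatrix (nonneg_kronecker maxEnt_nonneg maxEnt_nonneg) _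
  · rw [swapChannel_apply]
    exact trace_submatrix_equiv X (Equiv.prodComm _ _)

variable {Ahat Bhat : Type*}

theorem isSwapFeasible_zero_zero_zero_one [Finite Ahat] [Finite Bhat] [DecidableEq Ahat]
    [DecidableEq Bhat] (hd : 2 ≤ d) :
    IsSwapFeasible d (0 : Matrix (Ahat × Bhat) (Ahat × Bhat) ℂ) 0 0 1 := by
  have := Fintype.ofFinite Ahat
  have := Fintype.ofFinite Bhat
  have one_lt : (1 : ℝ) < d := Nat.one_lt_cast.2 hd
  have coeff_nonneg : 0 ≤ 1 / ((d : ℝ) - 1) := one_div_nonneg.2 (sub_nonneg.2 one_lt.le)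
  constructor <;>
    simp only [smul_zero, zero_add, map_zero, LinearMap.map_smul_of_tower, partialTranspose₂_one,
      le_refl, zero_le_one]
  case ppt₂ | ppt₃ =>
    exact smul_nonneg coeff_nonneg (smul_nonneg (by positivity) zero_le_one)
  case ppt₁ | ppt₄ => exact smul_nonneg (by positivity) zero_le_one

variable [Fintype Ahat] [DecidableEq Ahat] [Fintype Bhat] [DecidableEq Bhat]
  {ρ : Matrix (Ahat × Bhat) (Ahat × Bhat) ℂ} {k : ℝ}

theorem exists_isPPTChoi_of_mem_swapObjective (hd : 2 ≤ d) (hρ : 0 ≤ ρ)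
    (hk : k ∈ swapObjective d ρ) :
    ∃ J : Matrix (((Fin d × Ahat) × (Fin d × Bhat)) × (Fin d × Fin d))
        (((Fin d × Ahat) × (Fin d × Bhat)) × (Fin d × Fin d)) ℂ,
      IsPPTChoi J ∧ k • choi (swapChannel d) ≤ contractResource ρ J := by
  have := Fin.nontrivial_iff_two_le.2 hd
  obtain ⟨K, L, M, N, h, rfl⟩ := hk
  rw [← Fintype.card_fin d] at h
  refine ⟨twirledChoi (Fin d) K L M N, isPPTChoi_twirledChoi h, ?_⟩
  rw [choi_swapChannel, ← card_sq_smul_swapProj]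
  exact smul_swapProj_le_contractResource_twirledChoi hρ h

theorem exists_mem_swapObjective_of_isPPTChoi (hd : 2 ≤ d)
    (ρ : Matrix (Ahat × Bhat) (Ahat × Bhat) ℂ)
    {J : Matrix (((Fin d × Ahat) × (Fin d × Bhat)) × (Fin d × Fin d))
      (((Fin d × Ahat) × (Fin d × Bhat)) × (Fin d × Fin d)) ℂ} (hJ : IsPPTChoi J) :
    ∃ k ∈ swapObjective d ρ,
      (swapProj (Fin d) * (choi (swapChannel d) - contractResource ρ J)).trace.re =
        (1 - k) * Fintype.card (Fin d × Fin d) := by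
  have := Fin.nontrivial_iff_two_le.2 hd
  refine ⟨_, ⟨_, _, _, _, Fintype.card_fin d ▸ isSwapFeasible_legEffect hJ, rfl⟩, ?_⟩
  have card_ne_zero : (Fintype.card (Fin d × Fin d) : ℝ) ≠ 0 :=
    Nat.cast_ne_zero.2 Fintype.card_ne_zero
  have trace_swap : (swapProj (Fin d) * choi (swapChannel d)).trace.re =
      Fintype.card (Fin d × Fin d) := by
    rw [choi_swapChannel, ← card_sq_smul_swapProj, Matrix.mul_smul,
      (isStarProjection_swapProj (Fin d)).isIdempotentElem.eq, trace_smul, trace_swapProj]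
    simp [sq]
  rw [Matrix.mul_sub, trace_sub, Complex.sub_re, trace_swap, trace_mul_legEffect_maxEntProj,
    Complex.smul_re, smul_eq_mul, sub_mul, one_mul, mul_right_comm, inv_mul_cancel₀ card_ne_zero,
    one_mul]

theorem swapObjective_nonempty (hd : 2 ≤ d) (ρ : Matrix (Ahat × Bhat) (Ahat × Bhat) ℂ) :
    (swapObjective d ρ).Nonempty :=
  ⟨_, 0, 0, 0, 1, isSwapFeasible_zero_zero_zero_one hd, rfl⟩

theorem le_one_of_mem_swapObjective (hρ : IsState ρ) (hk : k ∈ swapObjective d ρ) : k ≤ 1 := by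
  obtain ⟨K, L, M, N, h, rfl⟩ := hk
  have K_le_one : K ≤ 1 := by
    rw [← h.sum_eq, add_assoc, add_assoc]
    exact le_add_of_nonneg_right (add_nonneg h.L_nonneg (add_nonneg h.M_nonneg h.N_nonneg))
  have trace_nonneg := trace_mul_re_nonneg hρ.1 (sub_nonneg.2 K_le_one)
  rwa [Matrix.mul_sub, Matrix.mul_one, trace_sub, hρ.2, Complex.sub_re, Complex.one_re,
    sub_nonneg] at trace_nonneg

theorem bddAbove_swapObjective (hρ : IsState ρ) : BddAbove (swapObjective d ρ) :=
  ⟨1, fun _ => le_one_of_mem_swapObjective hρ⟩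

theorem mul_sInf_eq_one_sub_sSup {c : ℝ} {S T : Set ℝ} (hc : 0 < c) (hS : S.Nonempty)
    (hb : BddAbove S) (hST : ∀ k ∈ S, ∃ t ∈ T, c * t ≤ 1 - k)
    (hTS : ∀ t ∈ T, ∃ k ∈ S, 1 - k ≤ c * t) : c * sInf T = 1 - sSup S := by
  have lower_bound : (1 - sSup S) / c ∈ lowerBounds T := fun t ht => by
    obtain ⟨k, hk, hkt⟩ := hTS t ht
    rw [div_le_iff₀' hc]
    linarith [le_csSup hb hk]
  have hT : T.Nonempty := by
    obtain ⟨k, hk⟩ := hS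
    obtain ⟨t, ht, _⟩ := hST k hk
    exact ⟨t, ht⟩
  refine le_antisymm (le_sub_comm.1 (csSup_le hS fun k hk => ?_))
    ((div_le_iff₀' hc).1 (le_csInf hT lower_bound))
  obtain ⟨t, ht, htk⟩ := hST k hk
  linarith [mul_le_mul_of_nonneg_left (csInf_le ⟨_, lower_bound⟩ ht) hc.le]

theorem pptError_swapChannel (hd : 2 ≤ d) (hρ : IsState ρ) :
    pptError (swapChannel d) ρ = 1 - sSup (swapObjective d ρ) := by
  have := Fin.nontrivial_iff_two_le.2 hd
  refine mul_sInf_eq_one_sub_sSup one_half_pos (swapObjective_nonempty hd ρ)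
    (bddAbove_swapObjective hρ) ?_ ?_
  · intro k hk
    obtain ⟨J, hJ, hle⟩ := exists_isPPTChoi_of_mem_swapObjective hd hρ.1 hk
    obtain ⟨hP, hPPT⟩ := isPPTChoi_choi_iff.1 ((choi_ofChoi J).symm ▸ hJ)
    refine ⟨_, ⟨ofChoi J, hP, hPPT, rfl⟩, ?_⟩
    have dist_le := diamondDist_le_of_smul_choi_le (isChannel_swapChannel d)
      (isChannel_simulate hP hρ) (le_one_of_mem_swapObjective hρ hk)
      (by rwa [choi_simulate, choi_ofChoi])
    linarith
  · rintro _ ⟨P, hP, hPPT, rfl⟩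
    obtain ⟨k, hk, trace_eq⟩ :=
      exists_mem_swapObjective_of_isPPTChoi hd ρ (isPPTChoi_choi_iff.2 ⟨hP, hPPT⟩)
    refine ⟨k, hk, ?_⟩
    have test := isStarProjection_swapProj (Fin d)
    have le_dist := two_mul_trace_le_diamondDist_simulate (isChannel_swapChannel d) hP hρ
      test.nonneg test.le_one
    rw [trace_eq, mul_comm (1 - k), inv_mul_cancel_left₀
      (Nat.cast_ne_zero.2 Fintype.card_ne_zero)] at le_dist
    linarith

theorem simValue_swapChannel (hd : 2 ≤ d) (hρ : IsState ρ) :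
    simValue (swapChannel d) ρ = 1 - sSup (swapObjective d ρ) := by
  have := Fin.nontrivial_iff_two_le.2 hd
  rw [simValue, ← one_mul (sInf _)]
  refine mul_sInf_eq_one_sub_sSup one_pos (swapObjective_nonempty hd ρ)
    (bddAbove_swapObjective hρ) ?_ ?_
  · intro k hk
    obtain ⟨J, hJ, hle⟩ := exists_isPPTChoi_of_mem_swapObjective hd hρ.1 hk
    have feasible := isSimFeasible_of_smul_choi_le (isChannel_swapChannel d) hJ
      (le_one_of_mem_swapObjective hρ hk) hle
    exact ⟨1 - k, ⟨_, J, feasible⟩, (one_mul _).le⟩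
  · rintro μ ⟨Z, J, h⟩
    obtain ⟨k, hk, trace_eq⟩ :=
      exists_mem_swapObjective_of_isPPTChoi hd ρ ⟨h.P_nonneg, h.ppt, h.trace_eq⟩
    have test := isStarProjection_swapProj (Fin d)
    have trace_le := h.trace_mul_le test.nonneg test.le_one
    rw [trace_eq] at trace_le
    rw [one_mul]
    exact ⟨k, hk, le_of_mul_le_mul_right trace_le (Nat.cast_pos.2 Fintype.card_pos)⟩

end SwapChannel

end PPTSim

theorem mainTheorem3 {Ahat Bhat : Type*} [Fintype Ahat] [DecidableEq Ahat]
    [Fintype Bhat] [DecidableEq Bhat] (d : ℕ) (hd : 2 ≤ d)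
    (ρ : Matrix (Ahat × Bhat) (Ahat × Bhat) ℂ) (hρ : PPTSim.IsState ρ) :
    (PPTSim.swapObjective d ρ).Nonempty ∧ BddAbove (PPTSim.swapObjective d ρ) ∧
      PPTSim.pptError (PPTSim.swapChannel d) ρ = 1 - sSup (PPTSim.swapObjective d ρ) ∧
      PPTSim.simValue (PPTSim.swapChannel d) ρ = 1 - sSup (PPTSim.swapObjective d ρ) := by
  exact ⟨PPTSim.swapObjective_nonempty hd ρ, PPTSim.bddAbove_swapObjective hρ,
    PPTSim.pptError_swapChannel hd hρ, PPTSim.simValue_swapChannel hd hρ⟩
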